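/- Let $\mathfrak{S}_2=\{(z_1,z_2)\in\mathbb{C}^2 : z_1+\overline{z_1}-z_2\overline{z_2}>0\}$ and $\partial\mathfrak{S}_2=\{(z_1,z_2)\in\mathbb{C}^2 : z_1+\overline{z_1}=z_2\overline{z_2}\}$. For $Z=(z_1,z_2)$ and $W=(w_1,w_2)$ in $\mathbb{C}^2$ put $\rho(Z,W)=\overline{z_1}+w_1-\overline{z_2}\,w_2$, $\rho(Z)=\rho(Z,Z)$ and $\overline{Z}=(\overline{z_1},\overline{z_2})$. For $k\in\mathbb{Z}$, $s\in\mathbb{C}$ and $Z\in\mathfrak{S}_2$, $W\in\partial\mathfrak{S}_2$, let $$P_k(Z,W;s)=\rho(Z)^{s}\,\rho(Z,W)^{k-s}\,\rho(\overline{Z},\overline{W})^{-k-s}$$ be the Poisson kernel of weight $k$. All complex powers are taken with the principal branch. Let $dm$ be the Lebesgue measure on $\partial\mathfrak{S}_2$, that is, the image of the Lebesgue measure on $\mathbb{C}\times\mathbb{R}$ under $(w,v)\mapsto(\tfrac12|w|^2+iv,\,w)$. **Corollary 4.12.** Let $k\in\{0,1,-1\}$, $s\in\mathbb{C}$ with $\operatorname{Re}s>1$,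 $Z\in\mathfrak{S}_2$ and $W'\in\partial\mathfrak{S}_2$. Then $$\int_{\partial\mathfrak{S}_2}P_k(Z,W;s)\,\rho(W,W')^{s+k-2}\,\rho(\overline{W},\overline{W'})^{s-k-2}\,dm(W)=\frac{\pi^{3/2}\,\Gamma(s-\frac12)}{(|k|+s-1)\,\Gamma(s)}\,4^{s-1}\,P_k(Z,W';2-s),$$ where the integral on the left converges absolutely. -/

import Mathlib

/-- The complex conjugate of a point of `ℂ²`, taken coordinatewise. -/
def conjPt (Z : ℂ × ℂ) : ℂ × ℂ :=
  (starRingEnd ℂ Z.1, starRingEnd ℂ Z.2)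

/-- The Siegel domain of type II: `z₁ + z̄₁ - z₂ z̄₂ > 0`
(the left side is always real, so its real part carries the condition). -/
def siegelDomain : Set (ℂ × ℂ) :=
  {Z | 0 < (Z.1 + starRingEnd ℂ Z.1 - Z.2 * starRingEnd ℂ Z.2).re}

/-- The boundary of the Siegel domain: `z₁ + z̄₁ = z₂ z̄₂`. -/
def siegelBoundary : Set (ℂ × ℂ) :=
  {Z | Z.1 + starRingEnd ℂ Z.1 = Z.2 * starRingEnd ℂ Z.2}

/-- `ρ(Z, W) = z̄₁ + w₁ - z̄₂ w₂`. -/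
def rho (Z W : ℂ × ℂ) : ℂ :=
  starRingEnd ℂ Z.1 + W.1 - starRingEnd ℂ Z.2 * W.2

/-- The parametrization `(w, v) ↦ (|w|² / 2 + i v, w)` of the boundary by `ℂ × ℝ`. -/
noncomputable def boundaryPoint (p : ℂ × ℝ) : ℂ × ℂ :=
  (((‖p.1‖ ^ 2 / 2 : ℝ) : ℂ) + Complex.I * (p.2 : ℂ), p.1)

/-- The Lebesgue measure on the boundary: the image of the Lebesgue measure `dm(w) dv` on `ℂ × ℝ`
under the parametrization, as a measure on `ℂ²` carried by the boundary. -/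
noncomputable def boundaryMeasure : MeasureTheory.Measure (ℂ × ℂ) :=
  MeasureTheory.Measure.map boundaryPoint MeasureTheory.volume

/-- The Poisson kernel of weight `k`:
`P_k(Z, W; s) = ρ(Z)^s ρ(Z, W)^(k - s) ρ(Z̄, W̄)^(-k - s)`, where `ρ(Z) = ρ(Z, Z)`.
All powers are principal. -/
noncomputable def weightedPoisson (k : ℤ) (Z W : ℂ × ℂ) (s : ℂ) : ℂ :=
  rho Z Z ^ s * rho Z W ^ ((k : ℂ) - s) * rho (conjPt Z) (conjPt W) ^ (-(k : ℂ) - s)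

/-! Every base of a complex power has nonnegative real part, so almost everywhere each conjugate
pair of principal powers merges into `twistedPower`, that is `|x|^(-2s) (x/x̄)^k`. Unlike the
principal powers themselves, this function is multiplicative without any branch condition.

Heisenberg translations preserve both `rho` and the measure, so `W'` may be moved to the origin. The
inversion `(z₁, z₂) ↦ (1/z₁, z₂/z₁)` sends the origin to infinity: it multiplies `rho` by an
automorphy factor, and its Jacobian `|w₁|^(-4)` cancels the intertwining kernel exactly
(`intertwiningIntegrand_boundaryInversion`). What remains is a constant times the integral of
`twistedPower k s (rho Z* W)`, with `Z*` the inverted point.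

Another translation brings `Z*` to `(t, 0)`, where `rho` is `t + |w|²/2 + iv`. Integrating over `v`
(`integral_twistedPower_line`) gives a quotient of Gamma values times `(s-1)/(|k|+s-1)`; the radial
integral over `w` gives `π/(s-1) · t^(2-2s)` (`integral_twistedPower_prod`). Rewriting `t` through
`rho Z Z` yields the Poisson kernel at `2-s` (`cpow_scaling_identity`). -/

open MeasureTheory

/-! ### Power integrals over the real line and the complex plane -/

/-- The Gaussian integral against the density `u ^ (s - 1) * exp (-(A * u))`. -/
theorem integral_gammaGaussian (s : ℂ) (A : ℝ) {u : ℝ} (hu : 0 < u) :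
    ∫ v : ℝ, (u : ℂ) ^ (s - 1) * Complex.exp (-((A + v ^ 2 : ℝ) * u)) =
      (√Real.pi : ℂ) * ((u : ℂ) ^ (s - 1 / 2 - 1) * Complex.exp (-(A * u))) := by
  have h1 : ∀ v : ℝ, (u : ℂ) ^ (s - 1) * Complex.exp (-((A + v ^ 2 : ℝ) * u)) =
      (u : ℂ) ^ (s - 1) * Complex.exp (-(A * u)) * ((Real.exp (-u * v ^ 2) : ℝ) : ℂ) := by
    intro v
    push_cast
    rw [mul_assoc, ← Complex.exp_add]
    congr 2
    ring
  simp_rw [h1]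
  rw [integral_const_mul, integral_complex_ofReal, integral_gaussian, Real.sqrt_div' _ hu.le]
  have hu' : (u : ℂ) ≠ 0 := Complex.ofReal_ne_zero.mpr hu.ne'
  have h2 : (u : ℂ) ^ (s - 1) = (u : ℂ) ^ (s - 1 / 2 - 1) * (√u : ℝ) := by
    rw [Real.sqrt_eq_rpow, Complex.ofReal_cpow hu.le, ← Complex.cpow_add _ _ hu']
    congr 1
    push_cast
    ring
  have h3 : ((√u : ℝ) : ℂ) ≠ 0 := Complex.ofReal_ne_zero.mpr (Real.sqrt_pos.mpr hu).ne'
  rw [h2]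
  push_cast
  field_simp

theorem norm_gammaGaussian (s : ℂ) (B : ℝ) {u : ℝ} (hu : 0 < u) :
    ‖(u : ℂ) ^ (s - 1) * Complex.exp (-(B * u))‖ = u ^ (s.re - 1) * Real.exp (-(B * u)) := by
  rw [norm_mul, Complex.norm_cpow_eq_rpow_re_of_pos hu, Complex.norm_exp]
  simp

/-- This licenses Fubini for the Gamma representation of `(A + v²)^(-s)`. Integrating the norm over
`v` leaves `√π u^(Re s - 3/2) e^(-Au)`, which is integrable at zero because `Re s > 1/2`. -/
theorem integrable_gammaGaussian {s : ℂ} (hs : 1 / 2 < s.re) {A : ℝ} (hA : 0 < A) :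
    Integrable (fun q : ℝ × ℝ =>
      (q.2 : ℂ) ^ (s - 1) * Complex.exp (-((A + q.1 ^ 2 : ℝ) * q.2)))
      (volume.prod (volume.restrict (Set.Ioi 0))) := by
  have hmeas : Measurable (fun q : ℝ × ℝ =>
      (q.2 : ℂ) ^ (s - 1) * Complex.exp (-((A + q.1 ^ 2 : ℝ) * q.2))) := by
    fun_prop
  rw [integrable_prod_iff' hmeas.aestronglyMeasurable]
  constructor
  · refine (ae_restrict_iff' measurableSet_Ioi).mpr (Filter.Eventually.of_forall fun u hu => ?_)
    have hu : 0 < u := hu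
    rw [← integrable_norm_iff (by fun_prop)]
    refine ((integrable_exp_neg_mul_sq hu).const_mul
      (u ^ (s.re - 1) * Real.exp (-(A * u)))).congr (Filter.Eventually.of_forall fun v => ?_)
    simp only
    rw [norm_gammaGaussian s _ hu, mul_assoc, ← Real.exp_add]
    congr 2
    ring
  · have hpos : 0 < s.re - 1 / 2 := by linarith
    have hint : IntegrableOn (fun u : ℝ => u ^ (s.re - 1 / 2 - 1) * Real.exp (-(A * u)))
        (Set.Ioi 0) := by
      -- A non-integrable function has integral `0` by convention, whereas the Gamma integral is
      -- positive.
      by_contra h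
      have h0 := Real.integral_rpow_mul_exp_neg_mul_Ioi hpos hA
      rw [integral_undef h] at h0
      have : 0 < (1 / A) ^ (s.re - 1 / 2) * Real.Gamma (s.re - 1 / 2) :=
        mul_pos (by positivity) (Real.Gamma_pos_of_pos hpos)
      linarith
    refine (hint.const_mul √Real.pi).congr
      ((ae_restrict_iff' measurableSet_Ioi).mpr (Filter.Eventually.of_forall fun u hu => ?_))
    have hu : 0 < u := hu
    have h := integral_gammaGaussian (s.re : ℂ) A hu
    have h2 : ∀ v : ℝ, (u : ℂ) ^ ((s.re : ℂ) - 1) * Complex.exp (-((A + v ^ 2 : ℝ) * u)) =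
        ((‖(u : ℂ) ^ (s - 1) * Complex.exp (-((A + v ^ 2 : ℝ) * u))‖ : ℝ) : ℂ) := by
      intro v
      rw [norm_gammaGaussian s _ hu, Complex.ofReal_mul, Complex.ofReal_cpow hu.le]
      push_cast
      rfl
    simp_rw [h2] at h
    rw [integral_complex_ofReal] at h
    simp only
    rw [← Complex.ofReal_inj, h]
    push_cast
    rw [Complex.ofReal_cpow hu.le]
    push_cast
    rfl

/-- The integral of `(A + v ^ 2) ^ (-s)` over the real line. -/
theorem integral_add_sq_cpow {s : ℂ} (hs : 1 / 2 < s.re) {A : ℝ} (hA : 0 < A) :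
    Integrable (fun v : ℝ => ((A + v ^ 2 : ℝ) : ℂ) ^ (-s)) ∧
      ∫ v : ℝ, ((A + v ^ 2 : ℝ) : ℂ) ^ (-s) =
        √Real.pi * Complex.Gamma (s - 1 / 2) / Complex.Gamma s * (A : ℂ) ^ (1 / 2 - s) := by
  have hs0 : 0 < s.re := by linarith
  have hG : Complex.Gamma s ≠ 0 := Complex.Gamma_ne_zero_of_re_pos hs0
  have hinv : ∀ B : ℝ, 0 < B → ∀ z : ℂ, (1 / B : ℂ) ^ z = (B : ℂ) ^ (-z) := by
    intro B hB z
    rw [one_div, Complex.inv_cpow _ _ (by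
      rw [Complex.arg_ofReal_of_nonneg hB.le]; exact Real.pi_pos.ne), Complex.cpow_neg]
  have hint := integrable_gammaGaussian hs hA
  have hin : ∀ v : ℝ, ∫ u : ℝ in Set.Ioi 0,
      (u : ℂ) ^ (s - 1) * Complex.exp (-((A + v ^ 2 : ℝ) * u)) =
        ((A + v ^ 2 : ℝ) : ℂ) ^ (-s) * Complex.Gamma s := by
    intro v
    have hB : 0 < A + v ^ 2 := by positivity
    rw [Complex.integral_cpow_mul_exp_neg_mul_Ioi hs0 hB, hinv _ hB]
  constructor
  · have h := hint.integral_prod_left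
    simp only [hin] at h
    refine (h.mul_const (Complex.Gamma s)⁻¹).congr (Filter.Eventually.of_forall fun v => ?_)
    simp only
    field_simp
  -- Integrating over `u` inside gives `Γ(s)` times the target; integrating over `v` inside gives a
  -- Gamma integral at `s - 1/2`.
  · have h := integral_integral_swap (f := fun (v u : ℝ) =>
      (u : ℂ) ^ (s - 1) * Complex.exp (-((A + v ^ 2 : ℝ) * u))) hint
    simp only [hin] at h
    rw [integral_mul_const, setIntegral_congr_fun measurableSet_Ioi
      (fun u hu => integral_gammaGaussian s A hu), integral_const_mul,
      Complex.integral_cpow_mul_exp_neg_mul_Ioi (by simp; linarith) hA, hinv _ hA] at h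
    rw [neg_sub] at h
    field_simp
    rw [h]
    ring_nf

/-- The integral of a power of `c + ‖w‖ ^ 2 / 2` over the complex plane. -/
theorem integral_add_normSq_cpow {p : ℂ} (hp : 1 < p.re) {c : ℝ} (hc : 0 < c) :
    Integrable (fun w : ℂ => ((c + ‖w‖ ^ 2 / 2 : ℝ) : ℂ) ^ (-p)) ∧
      ∫ w : ℂ, ((c + ‖w‖ ^ 2 / 2 : ℝ) : ℂ) ^ (-p) =
        2 * Real.pi / (p - 1) * (c : ℂ) ^ (1 - p) := by
  have hp1 : p - 1 ≠ 0 := by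
    intro h
    have := congrArg Complex.re h
    simp at this
    linarith
  -- In polar coordinates the Jacobian `r` is the derivative of `c + r²/2`, so the radial integrand
  -- has an explicit primitive.
  have hB : ∀ r : ℝ, 0 < c + r ^ 2 / 2 := fun r => by positivity
  have hderiv : ∀ q : ℂ, q - 1 ≠ 0 → ∀ r : ℝ, HasDerivAt
      (fun r : ℝ => -((c + r ^ 2 / 2 : ℝ) : ℂ) ^ (1 - q) / (q - 1))
      ((r : ℂ) * ((c + r ^ 2 / 2 : ℝ) : ℂ) ^ (-q)) r := by
    intro q hq r
    have h1 : HasDerivAt (fun r : ℝ => (c + r ^ 2 / 2 : ℝ)) r r := by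
      have := (((hasDerivAt_id r).pow 2).div_const 2).const_add c
      simpa using this
    have h2 := ((hasDerivAt_id ((c + r ^ 2 / 2 : ℝ) : ℂ)).cpow_const (c := 1 - q)
      (Or.inl (by simpa only [id, Complex.ofReal_re] using hB r))).comp r h1.ofReal_comp
    have h3 := h2.neg.div_const (q - 1)
    refine h3.congr_deriv ?_
    simp only [id, mul_one]
    rw [show 1 - q - 1 = -q by ring]
    field_simp
    ring
  have hatTop : Filter.Tendsto (fun r : ℝ => c + r ^ 2 / 2) Filter.atTop Filter.atTop :=
    Filter.tendsto_atTop_add_const_left _ _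
      ((Filter.tendsto_pow_atTop two_ne_zero).atTop_div_const two_pos)
  have htend : ∀ q : ℂ, 1 < q.re → Filter.Tendsto
      (fun r : ℝ => -((c + r ^ 2 / 2 : ℝ) : ℂ) ^ (1 - q) / (q - 1)) Filter.atTop (nhds 0) := by
    intro q hq
    have h2 : Filter.Tendsto (fun r : ℝ => ((c + r ^ 2 / 2 : ℝ) : ℂ) ^ (1 - q)) Filter.atTop
        (nhds 0) := by
      rw [tendsto_zero_iff_norm_tendsto_zero]
      have h3 := (tendsto_rpow_neg_atTop (y := q.re - 1) (by linarith)).comp hatTop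
      refine h3.congr fun r => ?_
      rw [Complex.norm_cpow_eq_rpow_re_of_pos (hB r)]
      simp
    simpa using h2.neg.div_const (q - 1)
  have hreal : IntegrableOn (fun r : ℝ => r * (c + r ^ 2 / 2) ^ (-p.re)) (Set.Ioi 0) := by
    have hq : p.re - 1 ≠ 0 := by linarith
    refine integrableOn_Ioi_deriv_of_nonneg' (l := 0)
      (g := fun r : ℝ => -(c + r ^ 2 / 2) ^ (1 - p.re) / (p.re - 1)) (fun r _ => ?_)
      (fun r hr => ?_) ?_
    · have h1 : HasDerivAt (fun r : ℝ => (c + r ^ 2 / 2 : ℝ)) r r := by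
        have := (((hasDerivAt_id r).pow 2).div_const 2).const_add c
        simpa using this
      refine ((h1.rpow_const (p := 1 - p.re) (Or.inl (hB r).ne')).neg.div_const
        (p.re - 1)).congr_deriv ?_
      rw [show 1 - p.re - 1 = -p.re by ring]
      field_simp
      ring
    · have : 0 < r := hr
      have := hB r
      positivity
    · have h3 := (tendsto_rpow_neg_atTop (y := p.re - 1) (by linarith)).comp hatTop
      simpa [Function.comp_def] using h3.neg.div_const (p.re - 1)
  have hci : IntegrableOn (fun r : ℝ => (r : ℂ) * ((c + r ^ 2 / 2 : ℝ) : ℂ) ^ (-p))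
      (Set.Ioi 0) := by
    refine Integrable.mono' hreal (by fun_prop) ?_
    refine (ae_restrict_iff' measurableSet_Ioi).mpr (Filter.Eventually.of_forall fun r hr => ?_)
    have hr : 0 < r := hr
    rw [norm_mul, Complex.norm_cpow_eq_rpow_re_of_pos (hB r), Complex.norm_real,
      Real.norm_of_nonneg hr.le]
    simp
  constructor
  · rw [integrable_fun_norm_addHaar volume (f := fun r : ℝ => ((c + r ^ 2 / 2 : ℝ) : ℂ) ^ (-p))]
    simpa using hci
  · rw [integral_fun_norm_addHaar volume (fun r : ℝ => ((c + r ^ 2 / 2 : ℝ) : ℂ) ^ (-p))]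
    have := integral_Ioi_of_hasDerivAt_of_tendsto' (fun r _ => hderiv p hp1 r) hci (htend p hp)
    simp only [Complex.finrank_real_complex, pow_one, Complex.real_smul, Nat.add_one_sub_one]
    rw [this]
    simp [Measure.real]
    ring_nf

/-! ### Twisted powers -/

/-- The homogeneous function `|x| ^ (-2 s) (x / x̄) ^ k` on the complex plane. -/
noncomputable def twistedPower (k : ℤ) (s x : ℂ) : ℂ :=
  (Complex.normSq x : ℂ) ^ (-s) * (x / starRingEnd ℂ x) ^ k

/-- Off the negative real axis the principal logarithm commutes with conjugation, so `log x + log x̄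
= log |x|²`. -/
theorem cpow_mul_conj_cpow (k : ℤ) (s : ℂ) {x : ℂ} (hx : x ≠ 0) (harg : x.arg ≠ Real.pi) :
    x ^ ((k : ℂ) - s) * starRingEnd ℂ x ^ (-(k : ℂ) - s) = twistedPower k s x := by
  have hc : starRingEnd ℂ x ≠ 0 := (map_ne_zero _).mpr hx
  have hn : (Complex.normSq x : ℂ) ≠ 0 := by
    exact_mod_cast (Complex.normSq_pos.mpr hx).ne'
  have key : x ^ (-s) * starRingEnd ℂ x ^ (-s) = (Complex.normSq x : ℂ) ^ (-s) := by
    rw [Complex.cpow_def_of_ne_zero hx, Complex.cpow_def_of_ne_zero hc,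
      Complex.cpow_def_of_ne_zero hn, ← Complex.exp_add, ← add_mul, Complex.log_conj _ harg,
      Complex.add_conj, Complex.log_re, ← Complex.ofReal_log (Complex.normSq_nonneg x),
      Complex.normSq_eq_norm_sq, Real.log_pow]
    norm_num
  rw [twistedPower, ← key, sub_eq_add_neg, sub_eq_add_neg, Complex.cpow_add _ _ hx,
    Complex.cpow_add _ _ hc, Complex.cpow_neg (starRingEnd ℂ x) k, Complex.cpow_intCast,
    Complex.cpow_intCast, div_zpow]
  ring

theorem twistedPower_mul (k : ℤ) (s x y : ℂ) :
    twistedPower k s (x * y) = twistedPower k s x * twistedPower k s y := by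
  rw [twistedPower, twistedPower, twistedPower, Complex.normSq_mul, Complex.ofReal_mul,
    Complex.mul_cpow_ofReal_nonneg (Complex.normSq_nonneg x) (Complex.normSq_nonneg y), map_mul,
    mul_div_mul_comm, mul_zpow]
  ring

theorem twistedPower_conj (k : ℤ) (s x : ℂ) :
    twistedPower k s (starRingEnd ℂ x) = twistedPower (-k) s x := by
  rw [twistedPower, twistedPower, Complex.normSq_conj, Complex.conj_conj, zpow_neg, ← inv_zpow,
    inv_div]

theorem norm_twistedPower (k : ℤ) (s : ℂ) {x : ℂ} (hx : x ≠ 0) :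
    ‖twistedPower k s x‖ = Complex.normSq x ^ (-s.re) := by
  rw [twistedPower, norm_mul, Complex.norm_cpow_eq_rpow_re_of_pos (Complex.normSq_pos.mpr hx),
    norm_zpow, norm_div, RCLike.norm_conj, div_self (norm_ne_zero_iff.mpr hx), one_zpow, mul_one,
    Complex.neg_re]

theorem measurable_twistedPower (k : ℤ) (s : ℂ) : Measurable (twistedPower k s) := by
  have hq : Measurable fun x : ℂ => x / starRingEnd ℂ x :=
    measurable_id.div Complex.continuous_conj.measurable
  have h : Measurable fun x : ℂ => (x / starRingEnd ℂ x) ^ k := by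
    cases k with
    | ofNat n => simpa only [Int.ofNat_eq_natCast, zpow_natCast] using hq.pow_const n
    | negSucc n => 
      simp only [zpow_negSucc]
      exact (hq.pow_const (n + 1)).inv
  exact (((Complex.measurable_ofReal.comp
    Complex.continuous_normSq.measurable).pow_const (-s))).mul h

/-! ### Integrals of twisted powers over vertical lines and over `ℂ × ℝ` -/

theorem normSq_add_I_mul (a v : ℝ) :
    Complex.normSq ((a : ℂ) + Complex.I * v) = a ^ 2 + v ^ 2 := by
  rw [mul_comm Complex.I, Complex.normSq_add_mul_I]

theorem add_I_mul_ne_zero {a : ℝ} (ha : 0 < a) (v : ℝ) : (a : ℂ) + Complex.I * v ≠ 0 := by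
  intro h
  have := congrArg Complex.re h
  simp at this
  exact ha.ne' this

theorem integrable_twistedPower_line (k : ℤ) {s : ℂ} (hs : 1 / 2 < s.re) {a : ℝ} (ha : 0 < a) :
    Integrable fun v : ℝ => twistedPower k s (a + Complex.I * v) := by
  have h := (integral_add_sq_cpow hs (A := a ^ 2) (by positivity)).1
  refine Integrable.mono h ((measurable_twistedPower k s).comp
    (by fun_prop)).aestronglyMeasurable (Filter.Eventually.of_forall fun v => le_of_eq ?_)
  rw [norm_twistedPower _ _ (add_I_mul_ne_zero ha v), normSq_add_I_mul,
    Complex.norm_cpow_eq_rpow_re_of_pos (by positivity), Complex.neg_re]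

theorem sq_cpow_half_sub (s : ℂ) {a : ℝ} (ha : 0 < a) :
    ((a ^ 2 : ℝ) : ℂ) ^ (1 / 2 - s) = (a : ℂ) ^ (1 - 2 * s) := by
  rw [sq, Complex.ofReal_mul, Complex.mul_cpow_ofReal_nonneg ha.le ha.le,
    ← Complex.cpow_add _ _ (Complex.ofReal_ne_zero.mpr ha.ne')]
  congr 1
  ring

theorem integral_twistedPower_zero_line {s : ℂ} (hs : 1 / 2 < s.re) {a : ℝ} (ha : 0 < a) :
    ∫ v : ℝ, twistedPower 0 s (a + Complex.I * v) =
      √Real.pi * Complex.Gamma (s - 1 / 2) / Complex.Gamma s * (a : ℂ) ^ (1 - 2 * s) := by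
  rw [← sq_cpow_half_sub s ha, ← (integral_add_sq_cpow hs (A := a ^ 2) (by positivity)).2]
  refine integral_congr_ae (Filter.Eventually.of_forall fun v => ?_)
  simp only [twistedPower, normSq_add_I_mul, zpow_zero, mul_one]

/-- Only the part of `x/x̄` even in `v` contributes, namely `2a²/(a²+v²) - 1`. This reduces the
integral to weight zero at `s+1` and `s`, and the recurrence of `Γ` produces `(s-1)/s`. -/
theorem integral_twistedPower_one_line {s : ℂ} (hs : 1 / 2 < s.re) {a : ℝ} (ha : 0 < a) :
    ∫ v : ℝ, twistedPower 1 s (a + Complex.I * v) =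
      √Real.pi * Complex.Gamma (s - 1 / 2) / Complex.Gamma s * ((s - 1) / s) *
        (a : ℂ) ^ (1 - 2 * s) := by
  set f : ℝ → ℂ := fun v => twistedPower 1 s (a + Complex.I * v) with hf
  have hs1 : 1 / 2 < (s + 1).re := by simp; linarith
  have hA : 0 < a ^ 2 := by positivity
  obtain ⟨i0, e0⟩ := integral_add_sq_cpow hs hA
  obtain ⟨i1, e1⟩ := integral_add_sq_cpow hs1 hA
  have hfi : Integrable f := integrable_twistedPower_line 1 hs ha
  have hsum : ∀ v : ℝ, f v + f (-v) =
      2 * (2 * ((a : ℂ) ^ 2 * ((a ^ 2 + v ^ 2 : ℝ) : ℂ) ^ (-(s + 1))) -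
        ((a ^ 2 + v ^ 2 : ℝ) : ℂ) ^ (-s)) := by
    intro v
    have hB : ((a ^ 2 + v ^ 2 : ℝ) : ℂ) ≠ 0 :=
      Complex.ofReal_ne_zero.mpr (by positivity)
    have h1 := add_I_mul_ne_zero ha v
    have h2 := add_I_mul_ne_zero ha (-v)
    have h3 : ((a : ℂ) + Complex.I * v) * (a + Complex.I * (-v : ℝ)) =
        ((a ^ 2 + v ^ 2 : ℝ) : ℂ) := by
      push_cast
      linear_combination (-(v : ℂ) ^ 2) * Complex.I_sq
    have h4 : ((a ^ 2 + v ^ 2 : ℝ) : ℂ) ^ (-s) =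
        ((a ^ 2 + v ^ 2 : ℝ) : ℂ) ^ (-(s + 1)) * ((a ^ 2 + v ^ 2 : ℝ) : ℂ) := by
      rw [neg_add, ← sub_eq_add_neg, Complex.cpow_sub _ _ hB, Complex.cpow_one,
        div_mul_cancel₀ _ hB]
    have h5 : ∀ u : ℝ, starRingEnd ℂ ((a : ℂ) + Complex.I * u) =
        (a : ℂ) + Complex.I * (-u : ℝ) := by
      intro u
      simp
    simp only [hf, twistedPower, normSq_add_I_mul, zpow_one, h5, neg_neg, neg_sq, h4]
    rw [← h3] at hB ⊢
    field_simp
    push_cast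
    ring
  have h1 : ∫ v, (f v + f (-v)) = 2 * ∫ v, f v := by
    rw [integral_add hfi hfi.comp_neg, integral_neg_eq_self]
    ring
  have hs0 : s ≠ 0 := by
    rintro rfl
    norm_num at hs
  have hsh : s - 1 / 2 ≠ 0 := by
    intro h
    have := congrArg Complex.re h
    simp at this
    linarith
  have hG : Complex.Gamma s ≠ 0 := Complex.Gamma_ne_zero_of_re_pos (by linarith)
  have ha0 : (a : ℂ) ≠ 0 := Complex.ofReal_ne_zero.mpr ha.ne'
  simp only [hsum] at h1
  rw [integral_const_mul, integral_sub ((i1.const_mul _).const_mul _) i0, integral_const_mul,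
    integral_const_mul, e0, e1, Complex.Gamma_add_one _ hs0,
    show s + 1 - 1 / 2 = s - 1 / 2 + 1 by ring, Complex.Gamma_add_one _ hsh,
    sq_cpow_half_sub _ ha, sq_cpow_half_sub _ ha,
    show (1 : ℂ) - 2 * (s + 1) = 1 - 2 * s - (2 : ℕ) by push_cast; ring,
    Complex.cpow_sub _ _ ha0, Complex.cpow_natCast] at h1
  rw [← mul_left_cancel₀ two_ne_zero h1]
  field_simp
  ring

theorem integral_twistedPower_line {k : ℤ} (hk : k = 0 ∨ k = 1 ∨ k = -1) {s : ℂ}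
    (hs : 1 < s.re) {a : ℝ} (ha : 0 < a) :
    ∫ v : ℝ, twistedPower k s (a + Complex.I * v) =
      √Real.pi * Complex.Gamma (s - 1 / 2) / Complex.Gamma s * ((s - 1) / ((|k| : ℤ) + s - 1)) *
        (a : ℂ) ^ (1 - 2 * s) := by
  have hs' : 1 / 2 < s.re := by linarith
  rcases hk with rfl | rfl | rfl
  · have : s - 1 ≠ 0 := by
      intro h
      have := congrArg Complex.re h
      simp at this
      linarith
    rw [integral_twistedPower_zero_line hs' ha]
    simp [div_self this]
  · rw [integral_twistedPower_one_line hs' ha]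
    simp
  -- Reflecting `v` conjugates the argument, which exchanges the weights `1` and `-1`.
  · rw [← integral_neg_eq_self]
    have : ∀ v : ℝ, twistedPower (-1) s (a + Complex.I * (-v : ℝ)) =
        twistedPower 1 s (a + Complex.I * v) := by
      intro v
      rw [← twistedPower_conj]
      simp
    simp only [this]
    rw [integral_twistedPower_one_line hs' ha]
    simp

/-- The norm is the twisted power of weight zero at `Re s`, so absolute convergence reuses the
weight-zero formula; hence the cast to `ℂ`. -/
theorem integral_norm_twistedPower_line (k : ℤ) {s : ℂ} (hs : 1 / 2 < s.re) {a : ℝ}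
    (ha : 0 < a) :
    ((∫ v : ℝ, ‖twistedPower k s (a + Complex.I * v)‖ : ℝ) : ℂ) =
      √Real.pi * Complex.Gamma ((s.re : ℂ) - 1 / 2) / Complex.Gamma (s.re : ℂ) *
        (a : ℂ) ^ (1 - 2 * (s.re : ℂ)) := by
  rw [← integral_twistedPower_zero_line (s := (s.re : ℂ)) (by simpa using hs) ha,
    ← integral_complex_ofReal]
  refine integral_congr_ae (Filter.Eventually.of_forall fun v => ?_)
  simp only
  rw [norm_twistedPower _ _ (add_I_mul_ne_zero ha v), twistedPower, zpow_zero, mul_one,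
    Complex.ofReal_cpow (Complex.normSq_nonneg _), Complex.ofReal_neg]

theorem integrable_twistedPower_prod (k : ℤ) {s : ℂ} (hs : 1 < s.re) {t : ℝ} (ht : 0 < t) :
    Integrable fun p : ℂ × ℝ =>
      twistedPower k s ((t + ‖p.1‖ ^ 2 / 2 : ℝ) + Complex.I * p.2) := by
  have hs' : 1 / 2 < s.re := by linarith
  have hpos : ∀ w : ℂ, 0 < t + ‖w‖ ^ 2 / 2 := fun w => by positivity
  have hmeas : Measurable fun p : ℂ × ℝ =>
      twistedPower k s ((t + ‖p.1‖ ^ 2 / 2 : ℝ) + Complex.I * p.2) :=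
    (measurable_twistedPower k s).comp (by fun_prop)
  rw [Measure.volume_eq_prod, integrable_prod_iff hmeas.aestronglyMeasurable]
  have hline : ∀ w : ℂ, Integrable fun v : ℝ =>
      twistedPower k s ((t + ‖w‖ ^ 2 / 2 : ℝ) + Complex.I * v) :=
    fun w => integrable_twistedPower_line k hs' (hpos w)
  refine ⟨Filter.Eventually.of_forall hline, ?_⟩
  have hp : 1 < (2 * (s.re : ℂ) - 1).re := by
    simp only [Complex.sub_re, Complex.mul_re, Complex.re_ofNat, Complex.ofReal_re,
      Complex.im_ofNat, Complex.ofReal_im, Complex.one_re]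
    linarith
  have h := (integral_add_normSq_cpow hp ht).1.const_mul
    (√Real.pi * Complex.Gamma ((s.re : ℂ) - 1 / 2) / Complex.Gamma (s.re : ℂ))
  simp only [neg_sub, ← integral_norm_twistedPower_line k hs' (hpos _)] at h
  simpa only [RCLike.re_to_complex, Complex.ofReal_re] using h.re

theorem integral_twistedPower_prod {k : ℤ} (hk : k = 0 ∨ k = 1 ∨ k = -1) {s : ℂ}
    (hs : 1 < s.re) {t : ℝ} (ht : 0 < t) :
    ∫ p : ℂ × ℝ, twistedPower k s ((t + ‖p.1‖ ^ 2 / 2 : ℝ) + Complex.I * p.2) =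
      (Real.pi : ℂ) ^ (3 / 2 : ℂ) * Complex.Gamma (s - 1 / 2) /
        (((|k| : ℤ) + s - 1) * Complex.Gamma s) * (t : ℂ) ^ (2 - 2 * s) := by
  have hint := integrable_twistedPower_prod k hs ht
  have hpos : ∀ w : ℂ, 0 < t + ‖w‖ ^ 2 / 2 := fun w => by positivity
  have hs1 : s - 1 ≠ 0 := by
    intro h
    have := congrArg Complex.re h
    simp at this
    linarith
  rw [Measure.volume_eq_prod, integral_prod _ hint]
  simp only [fun w => integral_twistedPower_line hk hs (hpos w)]
  have h2 := (integral_add_normSq_cpow (p := 2 * s - 1) (by simp; linarith) ht).2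
  rw [neg_sub] at h2
  have hpi : (Real.pi : ℂ) ^ (3 / 2 : ℂ) = Real.pi * (√Real.pi : ℝ) := by
    rw [Real.sqrt_eq_rpow, Complex.ofReal_cpow Real.pi_pos.le]
    nth_rewrite 2 [← Complex.cpow_one (Real.pi : ℂ)]
    rw [← Complex.cpow_add _ _ (Complex.ofReal_ne_zero.mpr Real.pi_pos.ne')]
    norm_num
  -- The denominator `2(s-1)` of the radial integral cancels the numerator `s-1` of the line
  -- integral.
  have h3 : (2 : ℂ) * s - 1 - 1 = 2 * (s - 1) := by ring
  rw [integral_const_mul, h2, hpi, h3, show 1 - (2 * s - 1) = 2 - 2 * s by ring]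
  rw [← div_div]
  field_simp

/-! ### The boundary and its Heisenberg translations -/

theorem boundaryPoint_fst_re (p : ℂ × ℝ) : (boundaryPoint p).1.re = ‖p.1‖ ^ 2 / 2 := by
  simp only [boundaryPoint, Complex.add_re, Complex.ofReal_re, Complex.re_mul_ofReal,
    Complex.I_re, zero_mul, add_zero]

theorem boundaryPoint_fst_im (p : ℂ × ℝ) : (boundaryPoint p).1.im = p.2 := by
  simp only [boundaryPoint, Complex.add_im, Complex.ofReal_im, Complex.im_mul_ofReal,
    Complex.I_im, one_mul, zero_add]

theorem siegelBoundary_boundaryPoint (p : ℂ × ℝ) : boundaryPoint p ∈ siegelBoundary := by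
  change (boundaryPoint p).1 + starRingEnd ℂ (boundaryPoint p).1 = p.1 * starRingEnd ℂ p.1
  rw [Complex.add_conj, Complex.mul_conj, Complex.normSq_eq_norm_sq, boundaryPoint_fst_re,
    mul_div_cancel₀ _ two_ne_zero]

theorem continuous_boundaryPoint : Continuous boundaryPoint := by
  unfold boundaryPoint
  fun_prop

theorem measurableEmbedding_boundaryPoint : MeasurableEmbedding boundaryPoint := by
  refine continuous_boundaryPoint.measurableEmbedding fun p q h => ?_
  have h1 : p.1 = q.1 := congrArg Prod.snd h
  have h2 := congrArg (fun Z : ℂ × ℂ => Z.1.im) h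
  simp only [boundaryPoint_fst_im] at h2
  exact Prod.ext h1 h2

theorem boundaryMeasure_restrict_siegelBoundary :
    boundaryMeasure.restrict siegelBoundary = boundaryMeasure := by
  refine Measure.restrict_eq_self_of_ae_mem ?_
  rw [boundaryMeasure, measurableEmbedding_boundaryPoint.ae_map_iff]
  exact Filter.Eventually.of_forall siegelBoundary_boundaryPoint

theorem exists_eq_boundaryPoint {W : ℂ × ℂ} (hW : W ∈ siegelBoundary) :
    ∃ p, W = boundaryPoint p := by
  refine ⟨(W.2, W.1.im), Prod.ext ?_ rfl⟩
  have h : W.1 + starRingEnd ℂ W.1 = W.2 * starRingEnd ℂ W.2 := hW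
  rw [Complex.add_conj, Complex.mul_conj, Complex.normSq_eq_norm_sq, Complex.ofReal_inj] at h
  apply Complex.ext
  · rw [boundaryPoint_fst_re, ← h, mul_div_cancel_left₀ _ two_ne_zero]
  · rw [boundaryPoint_fst_im]

theorem rho_conjPt (Z W : ℂ × ℂ) : rho (conjPt Z) (conjPt W) = starRingEnd ℂ (rho Z W) := by
  simp [rho, conjPt]

/-- Left translation by a point of the Heisenberg group, acting on `ℂ²`. -/
noncomputable def heisenbergAct (q : ℂ × ℝ) (Z : ℂ × ℂ) : ℂ × ℂ :=
  (Z.1 + (boundaryPoint q).1 + starRingEnd ℂ q.1 * Z.2, Z.2 + q.1)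

/-- The cross terms cancel, and the remaining constant vanishes by the boundary equation for `q`. -/
theorem rho_heisenbergAct (q : ℂ × ℝ) (Z W : ℂ × ℂ) :
    rho (heisenbergAct q Z) (heisenbergAct q W) = rho Z W := by
  have h : (boundaryPoint q).1 + starRingEnd ℂ (boundaryPoint q).1 =
      q.1 * starRingEnd ℂ q.1 := siegelBoundary_boundaryPoint q
  simp only [rho, heisenbergAct, map_add, map_mul, Complex.conj_conj]
  linear_combination h

/-- Left translation on the Heisenberg group in the coordinates of the boundary. -/
noncomputable def heisenbergShift (q : ℂ × ℝ) : ℂ × ℝ ≃ₜ ℂ × ℝ where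
  toFun p := (p.1 + q.1, p.2 + (q.2 + (starRingEnd ℂ q.1 * p.1).im))
  invFun p := (p.1 - q.1, p.2 - (q.2 + (starRingEnd ℂ q.1 * (p.1 - q.1)).im))
  left_inv p := by simp
  right_inv p := by simp
  continuous_toFun := by fun_prop
  continuous_invFun := by fun_prop

theorem boundaryPoint_heisenbergShift (q p : ℂ × ℝ) :
    boundaryPoint (heisenbergShift q p) = heisenbergAct q (boundaryPoint p) := by
  refine Prod.ext ?_ rfl
  simp only [boundaryPoint, heisenbergAct, heisenbergShift, Homeomorph.homeomorph_mk_coe,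
    Equiv.coe_fn_mk, ← Complex.normSq_eq_norm_sq, Complex.normSq_apply]
  apply Complex.ext <;> simp <;> ring

/-- The shift is a skew product: a translation in `w`, and for each fixed `w` a translation in `v`.
-/
theorem measurePreserving_heisenbergShift (q : ℂ × ℝ) :
    MeasurePreserving (heisenbergShift q) := by
  refine MeasurePreserving.skew_product (f := fun w : ℂ => w + q.1)
    (g := fun (w : ℂ) (v : ℝ) => v + (q.2 + (starRingEnd ℂ q.1 * w).im))
    (measurePreserving_add_right volume q.1) ?_ ?_
  · unfold Function.uncurry
    fun_prop
  · exact Filter.Eventually.of_forall fun w =>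
      (measurePreserving_add_right volume (q.2 + (starRingEnd ℂ q.1 * w).im)).map_eq

theorem integrable_comp_heisenbergShift (q : ℂ × ℝ) (g : ℂ × ℝ → ℂ) :
    Integrable (fun p => g (heisenbergShift q p)) ↔ Integrable g :=
  (measurePreserving_heisenbergShift q).integrable_comp_emb
    (heisenbergShift q).measurableEmbedding

theorem integral_comp_heisenbergShift (q : ℂ × ℝ) (g : ℂ × ℝ → ℂ) :
    ∫ p, g (heisenbergShift q p) = ∫ p, g p :=
  (measurePreserving_heisenbergShift q).integral_comp
    (heisenbergShift q).measurableEmbedding g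

/-! ### The inversion and its Jacobian -/

/-- The inversion of `ℂ²` that exchanges the origin and the point at infinity of the boundary. -/
noncomputable def siegelInversion (Z : ℂ × ℂ) : ℂ × ℂ :=
  (Z.1⁻¹, Z.2 / Z.1)

theorem rho_siegelInversion {Z W : ℂ × ℂ} (hZ : Z.1 ≠ 0) (hW : W.1 ≠ 0) :
    rho (siegelInversion Z) (siegelInversion W) = rho Z W * (starRingEnd ℂ Z.1)⁻¹ * W.1⁻¹ := by
  have hZ' : starRingEnd ℂ Z.1 ≠ 0 := (map_ne_zero _).mpr hZ
  simp only [rho, siegelInversion, map_div₀, map_inv₀]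
  field_simp
  ring

/-- The inversion in the coordinates of the boundary. -/
noncomputable def boundaryInversion (p : ℂ × ℝ) : ℂ × ℝ :=
  (p.1 / (boundaryPoint p).1, ((boundaryPoint p).1⁻¹).im)

theorem boundaryPoint_fst_ne_zero {p : ℂ × ℝ} (hp : p ≠ 0) : (boundaryPoint p).1 ≠ 0 := by
  intro h
  apply hp
  have h1 := congrArg Complex.re h
  have h2 := congrArg Complex.im h
  rw [boundaryPoint_fst_re, Complex.zero_re] at h1
  rw [boundaryPoint_fst_im, Complex.zero_im] at h2
  exact Prod.ext (by simpa using h1) h2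

theorem boundaryPoint_boundaryInversion {p : ℂ × ℝ} (hp : p ≠ 0) :
    boundaryPoint (boundaryInversion p) = siegelInversion (boundaryPoint p) := by
  have h0 := boundaryPoint_fst_ne_zero hp
  have hm : siegelInversion (boundaryPoint p) ∈ siegelBoundary := by
    have hb : (boundaryPoint p).1 + starRingEnd ℂ (boundaryPoint p).1 = (boundaryPoint p).2 *
      starRingEnd ℂ (boundaryPoint p).2 := siegelBoundary_boundaryPoint p
    have h0' : starRingEnd ℂ (boundaryPoint p).1 ≠ 0 := (map_ne_zero _).mpr h0
    simp only [siegelBoundary, siegelInversion, Set.mem_ofPred_eq, map_inv₀, map_div₀]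
    field_simp
    rw [← hb]
    ring
  obtain ⟨r, hr⟩ := exists_eq_boundaryPoint hm
  have h1 : r.1 = (boundaryInversion p).1 := (congrArg Prod.snd hr).symm
  have h2 : r.2 = (boundaryInversion p).2 := by
    have := congrArg (fun Z : ℂ × ℂ => Z.1.im) hr
    simp only [siegelInversion] at this
    rw [boundaryInversion, this, boundaryPoint_fst_im]
  rw [hr, Prod.ext h1 h2]

theorem boundaryInversion_ne_zero {p : ℂ × ℝ} (hp : p ≠ 0) : boundaryInversion p ≠ 0 := by
  intro h
  have h1 := boundaryPoint_boundaryInversion hp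
  rw [h] at h1
  have h2 := congrArg Prod.fst h1
  exact inv_ne_zero (boundaryPoint_fst_ne_zero hp)
    (by simpa [boundaryPoint, siegelInversion] using h2.symm)

theorem boundaryInversion_boundaryInversion {p : ℂ × ℝ} (hp : p ≠ 0) :
    boundaryInversion (boundaryInversion p) = p := by
  apply measurableEmbedding_boundaryPoint.injective
  rw [boundaryPoint_boundaryInversion (boundaryInversion_ne_zero hp),
    boundaryPoint_boundaryInversion hp]
  have h0 := boundaryPoint_fst_ne_zero hp
  refine Prod.ext ?_ ?_ <;> simp [siegelInversion]
  field_simp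

theorem injOn_boundaryInversion : Set.InjOn boundaryInversion {0}ᶜ := by
  intro p hp q hq h
  rw [← boundaryInversion_boundaryInversion hp, h, boundaryInversion_boundaryInversion hq]

theorem image_boundaryInversion : boundaryInversion '' {0}ᶜ = {0}ᶜ := by
  ext p
  constructor
  · rintro ⟨q, hq, rfl⟩
    exact boundaryInversion_ne_zero hq
  · intro hp
    exact ⟨_, boundaryInversion_ne_zero hp, boundaryInversion_boundaryInversion hp⟩

theorem det_complex_prod_real (L : ℂ × ℝ →L[ℝ] ℂ × ℝ) :
    L.det = (!![(L (1, 0)).1.re, (L (Complex.I, 0)).1.re, (L (0, 1)).1.re;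
      (L (1, 0)).1.im, (L (Complex.I, 0)).1.im, (L (0, 1)).1.im;
      (L (1, 0)).2, (L (Complex.I, 0)).2, (L (0, 1)).2]).det := by
  have h := LinearMap.det_toMatrix ((Complex.basisOneI.prod
    (Module.Basis.singleton (Fin 1) ℝ)).reindex finSumFinEquiv) (L : ℂ × ℝ →ₗ[ℝ] ℂ × ℝ)
  rw [ContinuousLinearMap.det, ← h]
  have h0 : (finSumFinEquiv : Fin 2 ⊕ Fin 1 ≃ Fin 3).symm 0 = Sum.inl 0 := rfl
  have h1 : (finSumFinEquiv : Fin 2 ⊕ Fin 1 ≃ Fin 3).symm 1 = Sum.inl 1 := rfl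
  have h2 : (finSumFinEquiv : Fin 2 ⊕ Fin 1 ≃ Fin 3).symm 2 = Sum.inr 0 := rfl
  congr 1
  ext i j
  fin_cases i <;> fin_cases j <;>
    simp [LinearMap.toMatrix_apply, h0, h1, h2]

/-- The derivative of the first coordinate of `boundaryPoint`. -/
noncomputable def boundaryPointDeriv (w : ℂ) : ℂ × ℝ →L[ℝ] ℂ :=
  (w.re • Complex.ofRealCLM.comp Complex.reCLM + w.im • Complex.ofRealCLM.comp Complex.imCLM).comp
    (ContinuousLinearMap.fst ℝ ℂ ℝ) +
  (Complex.I • Complex.ofRealCLM).comp (ContinuousLinearMap.snd ℝ ℂ ℝ)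

theorem hasFDerivAt_boundaryPoint_fst (p : ℂ × ℝ) :
    HasFDerivAt (fun p => (boundaryPoint p).1) (boundaryPointDeriv p.1) p := by
  have h1 : HasFDerivAt (fun p : ℂ × ℝ => p.1.re) (Complex.reCLM.comp
    (ContinuousLinearMap.fst ℝ ℂ ℝ)) p := Complex.reCLM.hasFDerivAt.comp p hasFDerivAt_fst
  have h2 : HasFDerivAt (fun p : ℂ × ℝ => p.1.im) (Complex.imCLM.comp
    (ContinuousLinearMap.fst ℝ ℂ ℝ)) p := Complex.imCLM.hasFDerivAt.comp p hasFDerivAt_fst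
  have h3 : HasFDerivAt (fun p : ℂ × ℝ => (p.2 : ℂ)) (Complex.ofRealCLM.comp
    (ContinuousLinearMap.snd ℝ ℂ ℝ)) p := Complex.ofRealCLM.hasFDerivAt.comp p hasFDerivAt_snd
  have h4 := ((h1.pow 2).add (h2.pow 2)).mul_const (1 / 2 : ℝ)
  have h5 := (Complex.ofRealCLM.hasFDerivAt.comp p h4).add (h3.const_mul Complex.I)
  refine (h5.congr_fderiv ?_).congr_of_eventuallyEq (Filter.Eventually.of_forall fun q => ?_)
  · ext x
    · simp [boundaryPointDeriv]
      ring
    · simp [boundaryPointDeriv]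
  · simp only [boundaryPoint, ← Complex.normSq_eq_norm_sq, Complex.normSq_apply]
    simp
    ring

/-- The derivative of `boundaryInversion`. -/
noncomputable def boundaryInversionDeriv (p : ℂ × ℝ) : ℂ × ℝ →L[ℝ] ℂ × ℝ :=
  (p.1 • (-((boundaryPoint p).1⁻¹) ^ 2) • boundaryPointDeriv p.1 +
    (boundaryPoint p).1⁻¹ • ContinuousLinearMap.fst ℝ ℂ ℝ).prod
  (Complex.imCLM.comp ((-((boundaryPoint p).1⁻¹) ^ 2) • boundaryPointDeriv p.1))

theorem hasFDerivAt_boundaryInversion {p : ℂ × ℝ} (hp : p ≠ 0) :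
    HasFDerivAt boundaryInversion (boundaryInversionDeriv p) p := by
  have h0 := boundaryPoint_fst_ne_zero hp
  have h1 : HasFDerivAt (fun p => ((boundaryPoint p).1)⁻¹)
      ((-((boundaryPoint p).1⁻¹) ^ 2) • boundaryPointDeriv p.1) p := by
    have := (hasDerivAt_inv h0).comp_hasFDerivAt_of_eq p (hasFDerivAt_boundaryPoint_fst p) rfl
    rw [inv_pow]
    exact this
  have h2 : HasFDerivAt (fun p : ℂ × ℝ => p.1) (ContinuousLinearMap.fst ℝ ℂ ℝ) p :=
    hasFDerivAt_fst
  exact ((h2.mul h1).prodMk (Complex.imCLM.hasFDerivAt.comp p h1))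

theorem det_boundaryInversionDeriv {p : ℂ × ℝ} (hp : p ≠ 0) :
    (boundaryInversionDeriv p).det = Complex.normSq ((boundaryPoint p).1⁻¹) ^ 2 := by
  have h0 := boundaryPoint_fst_ne_zero hp
  set e := (boundaryPoint p).1⁻¹ with he
  -- The boundary equation `|w|² = 2 Re z₁`, rewritten for `e = 1/z₁`; it is the only relation the
  -- determinant needs.
  have hrel : (p.1.re ^ 2 + p.1.im ^ 2) * (e.re ^ 2 + e.im ^ 2) = 2 * e.re := by
    have h1 : p.1.re ^ 2 + p.1.im ^ 2 = 2 * (boundaryPoint p).1.re := by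
      rw [boundaryPoint_fst_re, ← Complex.normSq_eq_norm_sq, Complex.normSq_apply]
      ring
    have h2 : e.re ^ 2 + e.im ^ 2 = (Complex.normSq (boundaryPoint p).1)⁻¹ := by
      rw [← map_inv₀, ← he, Complex.normSq_apply]
      ring
    rw [h1, h2, he, Complex.inv_re]
    ring
  rw [det_complex_prod_real, Matrix.det_fin_three, Complex.normSq_apply]
  simp [boundaryInversionDeriv, boundaryPointDeriv, ← he, sq]
  linear_combination ((e.re ^ 2 + e.im ^ 2) * e.re) * hrel

instance isAddHaarMeasure_volume_complex_prod_real :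
    (volume : Measure (ℂ × ℝ)).IsAddHaarMeasure := by
  rw [Measure.volume_eq_prod]
  infer_instance

theorem ae_ne_zero_complex_prod_real : ∀ᵐ p : ℂ × ℝ, p ≠ 0 := by
  rw [Measure.volume_eq_prod]
  exact compl_mem_ae_iff.mpr (measure_singleton (0 : ℂ × ℝ))

theorem restrict_compl_zero_complex_prod_real :
    (volume : Measure (ℂ × ℝ)).restrict {0}ᶜ = volume :=
  Measure.restrict_eq_self_of_ae_mem ae_ne_zero_complex_prod_real

/-- The inversion is a smooth involution of the complement of the origin, and the origin is a null
set. -/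
theorem integrable_comp_boundaryInversion (g : ℂ × ℝ → ℂ) :
    Integrable (fun p => Complex.normSq ((boundaryPoint p).1⁻¹) ^ 2 • g (boundaryInversion p)) ↔
      Integrable g := by
  have h := integrableOn_image_iff_integrableOn_abs_det_fderiv_smul volume
    (measurableSet_singleton (0 : ℂ × ℝ)).compl
    (fun p hp => (hasFDerivAt_boundaryInversion hp).hasFDerivWithinAt) injOn_boundaryInversion g
  rw [image_boundaryInversion, IntegrableOn, restrict_compl_zero_complex_prod_real] at h
  rw [h, IntegrableOn, restrict_compl_zero_complex_prod_real]
  refine integrable_congr ?_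
  filter_upwards [ae_ne_zero_complex_prod_real] with p hp
  rw [det_boundaryInversionDeriv hp, abs_sq]

theorem integral_comp_boundaryInversion (g : ℂ × ℝ → ℂ) :
    ∫ p, Complex.normSq ((boundaryPoint p).1⁻¹) ^ 2 • g (boundaryInversion p) = ∫ p, g p := by
  have h := integral_image_eq_integral_abs_det_fderiv_smul volume
    (measurableSet_singleton (0 : ℂ × ℝ)).compl
    (fun p hp => (hasFDerivAt_boundaryInversion hp).hasFDerivWithinAt) injOn_boundaryInversion g
  rw [image_boundaryInversion, restrict_compl_zero_complex_prod_real] at h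
  rw [h]
  refine integral_congr_ae ?_
  filter_upwards [ae_ne_zero_complex_prod_real] with p hp
  rw [det_boundaryInversionDeriv hp, abs_sq]

/-! ### Kernels on the domain under translation and inversion -/

theorem arg_ne_pi_of_re_nonneg {x : ℂ} (hx : 0 ≤ x.re) : x.arg ≠ Real.pi := by
  intro h
  linarith [(Complex.arg_eq_pi_iff.mp h).1]

theorem rho_self_eq (Z : ℂ × ℂ) :
    rho Z Z = ((2 * (Z.1.re - ‖Z.2‖ ^ 2 / 2) : ℝ) : ℂ) := by
  rw [rho, add_comm, Complex.add_conj, mul_comm (starRingEnd ℂ Z.2), Complex.mul_conj,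
    Complex.normSq_eq_norm_sq, ← Complex.ofReal_sub]
  congr 1
  ring

theorem mem_siegelDomain_iff {Z : ℂ × ℂ} : Z ∈ siegelDomain ↔ 0 < Z.1.re - ‖Z.2‖ ^ 2 / 2 := by
  have : Z.1 + starRingEnd ℂ Z.1 - Z.2 * starRingEnd ℂ Z.2 = rho Z Z := by
    rw [rho]
    ring
  rw [siegelDomain, Set.mem_ofPred_eq, this, rho_self_eq, Complex.ofReal_re]
  exact mul_pos_iff_of_pos_left two_pos

theorem mem_siegelDomain_iff_rho {Z : ℂ × ℂ} : Z ∈ siegelDomain ↔ 0 < (rho Z Z).re := by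
  rw [mem_siegelDomain_iff, rho_self_eq, Complex.ofReal_re]
  exact (mul_pos_iff_of_pos_left two_pos).symm

theorem fst_ne_zero_of_mem_siegelDomain {Z : ℂ × ℂ} (hZ : Z ∈ siegelDomain) : Z.1 ≠ 0 := by
  intro h
  rw [mem_siegelDomain_iff, h, Complex.zero_re] at hZ
  linarith [sq_nonneg ‖Z.2‖]

/-- The real part equals `Re z₁ - |z₂|²/2 + |z₂ - w|²/2`. Positivity keeps the principal powers away
from the cut. -/
theorem rho_boundaryPoint_re_pos {Z : ℂ × ℂ} (hZ : Z ∈ siegelDomain) (p : ℂ × ℝ) :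
    0 < (rho Z (boundaryPoint p)).re := by
  rw [mem_siegelDomain_iff, ← Complex.normSq_eq_norm_sq, Complex.normSq_apply] at hZ
  have h : (rho Z (boundaryPoint p)).re = Z.1.re + (boundaryPoint p).1.re -
      (Z.2.re * p.1.re + Z.2.im * p.1.im) := by
    rw [rho, show (boundaryPoint p).2 = p.1 from rfl]
    simp
  rw [h, boundaryPoint_fst_re, ← Complex.normSq_eq_norm_sq, Complex.normSq_apply]
  nlinarith [sq_nonneg (Z.2.re - p.1.re), sq_nonneg (Z.2.im - p.1.im)]

theorem weightedPoisson_eq {k : ℤ} {s : ℂ} {Z W : ℂ × ℂ} (h0 : rho Z W ≠ 0)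
    (hre : 0 ≤ (rho Z W).re) :
    weightedPoisson k Z W s = rho Z Z ^ s * twistedPower k s (rho Z W) := by
  rw [weightedPoisson, rho_conjPt, mul_assoc,
    cpow_mul_conj_cpow k s h0 (arg_ne_pi_of_re_nonneg hre)]

/-- The product of the Poisson kernel and the intertwining kernel. -/
noncomputable def intertwiningIntegrand (k : ℤ) (s : ℂ) (Z W' W : ℂ × ℂ) : ℂ :=
  weightedPoisson k Z W s * rho W W' ^ (s + (k : ℂ) - 2) *
    rho (conjPt W) (conjPt W') ^ (s - (k : ℂ) - 2)

theorem intertwiningIntegrand_heisenbergAct (k : ℤ) (s : ℂ) (q : ℂ × ℝ) (Z W' W : ℂ × ℂ) :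
    intertwiningIntegrand k s (heisenbergAct q Z) (heisenbergAct q W') (heisenbergAct q W) =
      intertwiningIntegrand k s Z W' W := by
  simp only [intertwiningIntegrand, weightedPoisson, rho_conjPt, rho_heisenbergAct]

/-- Since `s + k - 2 = k - (2 - s)`, the intertwining kernel is itself a twisted power, with
parameter `2 - s`. -/
theorem intertwiningIntegrand_eq (k : ℤ) (s : ℂ) {Z : ℂ × ℂ} (hZ : Z ∈ siegelDomain)
    {p : ℂ × ℝ} (hp : p ≠ 0) :
    intertwiningIntegrand k s Z 0 (boundaryPoint p) =
      rho Z Z ^ s * twistedPower k s (rho Z (boundaryPoint p)) *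
        twistedPower k (2 - s) (starRingEnd ℂ (boundaryPoint p).1) := by
  have h1 := rho_boundaryPoint_re_pos hZ p
  have h1' : rho Z (boundaryPoint p) ≠ 0 := fun h => by simp [h] at h1
  have h2 : rho (boundaryPoint p) 0 = starRingEnd ℂ (boundaryPoint p).1 := by simp [rho]
  have h3 : starRingEnd ℂ (boundaryPoint p).1 ≠ 0 :=
    (map_ne_zero _).mpr (boundaryPoint_fst_ne_zero hp)
  have h4 : 0 ≤ (starRingEnd ℂ (boundaryPoint p).1).re := by
    rw [Complex.conj_re, boundaryPoint_fst_re]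
    positivity
  rw [intertwiningIntegrand, weightedPoisson_eq h1' h1.le, rho_conjPt, h2, mul_assoc,
    ← cpow_mul_conj_cpow k (2 - s) h3 (arg_ne_pi_of_re_nonneg h4)]
  congr 3 <;> ring

theorem siegelInversion_siegelInversion {Z : ℂ × ℂ} (hZ : Z.1 ≠ 0) :
    siegelInversion (siegelInversion Z) = Z := by
  refine Prod.ext ?_ ?_ <;> simp only [siegelInversion, inv_inv]
  field_simp

theorem rho_siegelInversion_right {Z W : ℂ × ℂ} (hZ : Z.1 ≠ 0) (hW : W.1 ≠ 0) :
    rho Z (siegelInversion W) = rho (siegelInversion Z) W * starRingEnd ℂ Z.1 * W.1⁻¹ := by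
  have h := rho_siegelInversion (Z := siegelInversion Z) (inv_ne_zero hZ) hW
  rw [siegelInversion_siegelInversion hZ] at h
  simpa [siegelInversion] using h

/-- Conjugation flips the weight, so the phases cancel and the exponents of `|x|²` add up to `-2`.
With `x = 1/w₁` the prefactor is the Jacobian of the inversion. -/
theorem twistedPower_mul_twistedPower_conj (k : ℤ) (s : ℂ) {x : ℂ} (hx : x ≠ 0) :
    (Complex.normSq x : ℂ) ^ 2 *
      (twistedPower k s x * twistedPower k (2 - s) (starRingEnd ℂ x)) = 1 := by
  have hn : (Complex.normSq x : ℂ) ≠ 0 := by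
    exact_mod_cast (Complex.normSq_pos.mpr hx).ne'
  have hq : x / starRingEnd ℂ x ≠ 0 := div_ne_zero hx ((map_ne_zero _).mpr hx)
  rw [twistedPower_conj, twistedPower, twistedPower, mul_mul_mul_comm, ← zpow_add₀ hq,
    ← Complex.cpow_add _ _ hn, add_neg_cancel, zpow_zero, mul_one,
    show -s + -(2 - s) = -((2 : ℕ) : ℂ) by push_cast; ring, Complex.cpow_neg,
    Complex.cpow_natCast, mul_inv_cancel₀ (pow_ne_zero 2 hn)]

theorem intertwiningIntegrand_boundaryInversion (k : ℤ) (s : ℂ) {Z : ℂ × ℂ}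
    (hZ : Z ∈ siegelDomain) {p : ℂ × ℝ} (hp : p ≠ 0) :
    Complex.normSq ((boundaryPoint p).1⁻¹) ^ 2 •
        intertwiningIntegrand k s Z 0 (boundaryPoint (boundaryInversion p)) =
      rho Z Z ^ s * twistedPower k s (starRingEnd ℂ Z.1) *
        twistedPower k s (rho (siegelInversion Z) (boundaryPoint p)) := by
  have h0 := boundaryPoint_fst_ne_zero hp
  have h1 := twistedPower_mul_twistedPower_conj k s (inv_ne_zero h0)
  rw [intertwiningIntegrand_eq k s hZ (boundaryInversion_ne_zero hp),
    boundaryPoint_boundaryInversion hp,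
    rho_siegelInversion_right (fst_ne_zero_of_mem_siegelDomain hZ) h0, twistedPower_mul,
    twistedPower_mul, show (siegelInversion (boundaryPoint p)).1 = (boundaryPoint p).1⁻¹ from rfl,
    Complex.real_smul, Complex.ofReal_pow]
  linear_combination (rho Z Z ^ s * twistedPower k s (starRingEnd ℂ Z.1) *
        twistedPower k s (rho (siegelInversion Z) (boundaryPoint p))) * h1

theorem exists_heisenbergAct_eq (q : ℂ × ℝ) (Z : ℂ × ℂ) : ∃ Y, heisenbergAct q Y = Z := by
  refine ⟨(Z.1 - (boundaryPoint q).1 - starRingEnd ℂ q.1 * (Z.2 - q.1), Z.2 - q.1), ?_⟩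
  refine Prod.ext ?_ ?_ <;> simp only [heisenbergAct] <;> ring

theorem heisenbergAct_ofReal (Z : ℂ × ℂ) :
    heisenbergAct (Z.2, Z.1.im) (((Z.1.re - ‖Z.2‖ ^ 2 / 2 : ℝ) : ℂ), 0) = Z := by
  refine Prod.ext ?_ ?_
  · apply Complex.ext
    · simp only [heisenbergAct, Complex.add_re, boundaryPoint_fst_re, Complex.ofReal_re, mul_zero,
        add_zero, sub_add_cancel]
    · simp only [heisenbergAct, Complex.add_im, boundaryPoint_fst_im, Complex.ofReal_im, mul_zero,
        add_zero, zero_add]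
  · simp [heisenbergAct]

theorem rho_ofReal_boundaryPoint (t : ℝ) (p : ℂ × ℝ) :
    rho ((t : ℂ), 0) (boundaryPoint p) = (t + ‖p.1‖ ^ 2 / 2 : ℝ) + Complex.I * p.2 := by
  simp only [rho, boundaryPoint, Complex.conj_ofReal, map_zero, zero_mul, sub_zero]
  push_cast
  ring

theorem twistedPower_rho_heisenbergShift (k : ℤ) (s : ℂ) (Z : ℂ × ℂ) (p : ℂ × ℝ) :
    twistedPower k s (rho Z (boundaryPoint (heisenbergShift (Z.2, Z.1.im) p))) =
      twistedPower k s
        (((Z.1.re - ‖Z.2‖ ^ 2 / 2) + ‖p.1‖ ^ 2 / 2 : ℝ) + Complex.I * p.2) := by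
  have h := rho_heisenbergAct (Z.2, Z.1.im) (((Z.1.re - ‖Z.2‖ ^ 2 / 2 : ℝ) : ℂ), 0)
    (boundaryPoint p)
  rw [heisenbergAct_ofReal, rho_ofReal_boundaryPoint] at h
  rw [boundaryPoint_heisenbergShift, h]

/-! ### Evaluation of the integral -/

theorem integrable_twistedPower_rho (k : ℤ) {s : ℂ} (hs : 1 < s.re) {Z : ℂ × ℂ}
    (hZ : Z ∈ siegelDomain) :
    Integrable fun p => twistedPower k s (rho Z (boundaryPoint p)) := by
  rw [← integrable_comp_heisenbergShift (Z.2, Z.1.im)]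
  simp only [twistedPower_rho_heisenbergShift]
  exact integrable_twistedPower_prod k hs (mem_siegelDomain_iff.mp hZ)

theorem integral_twistedPower_rho {k : ℤ} (hk : k = 0 ∨ k = 1 ∨ k = -1) {s : ℂ} (hs : 1 < s.re)
    {Z : ℂ × ℂ} (hZ : Z ∈ siegelDomain) :
    ∫ p, twistedPower k s (rho Z (boundaryPoint p)) =
      (Real.pi : ℂ) ^ (3 / 2 : ℂ) * Complex.Gamma (s - 1 / 2) /
        (((|k| : ℤ) + s - 1) * Complex.Gamma s) *
        ((Z.1.re - ‖Z.2‖ ^ 2 / 2 : ℝ) : ℂ) ^ (2 - 2 * s) := by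
  rw [← integral_comp_heisenbergShift (Z.2, Z.1.im)]
  simp only [twistedPower_rho_heisenbergShift]
  exact integral_twistedPower_prod hk hs (mem_siegelDomain_iff.mp hZ)

theorem rho_self_eq_siegelInversion {Z : ℂ × ℂ} (hZ : Z ∈ siegelDomain) :
    rho Z Z = ((2 * (Complex.normSq Z.1 * ((siegelInversion Z).1.re -
      ‖(siegelInversion Z).2‖ ^ 2 / 2)) : ℝ) : ℂ) := by
  have h0 := fst_ne_zero_of_mem_siegelDomain hZ
  have h0' : starRingEnd ℂ Z.1 ≠ 0 := (map_ne_zero _).mpr h0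
  have h := rho_siegelInversion h0 h0
  rw [rho_self_eq (siegelInversion Z)] at h
  have h2 : rho Z Z = (Complex.normSq Z.1 : ℂ) *
      ((2 * ((siegelInversion Z).1.re - ‖(siegelInversion Z).2‖ ^ 2 / 2) : ℝ) : ℂ) := by
    rw [h, Complex.normSq_eq_conj_mul_self]
    field_simp
  rw [h2, ← Complex.ofReal_mul]
  congr 1
  ring

theorem siegelInversion_mem_siegelDomain {Z : ℂ × ℂ} (hZ : Z ∈ siegelDomain) :
    siegelInversion Z ∈ siegelDomain := by
  have h := mem_siegelDomain_iff_rho.mp hZ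
  have hn := Complex.normSq_pos.mpr (fst_ne_zero_of_mem_siegelDomain hZ)
  rw [rho_self_eq_siegelInversion hZ, Complex.ofReal_re] at h
  rw [mem_siegelDomain_iff]
  exact pos_of_mul_pos_right (pos_of_mul_pos_right h two_pos.le) hn.le

theorem integrable_intertwiningIntegrand (k : ℤ) {s : ℂ} (hs : 1 < s.re) {Z : ℂ × ℂ}
    (hZ : Z ∈ siegelDomain) :
    Integrable fun p => intertwiningIntegrand k s Z 0 (boundaryPoint p) := by
  rw [← integrable_comp_boundaryInversion]
  refine ((integrable_twistedPower_rho k hs (siegelInversion_mem_siegelDomain hZ)).const_mul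
    (rho Z Z ^ s * twistedPower k s (starRingEnd ℂ Z.1))).congr ?_
  filter_upwards [ae_ne_zero_complex_prod_real] with p hp
  exact (intertwiningIntegrand_boundaryInversion k s hZ hp).symm

/-- Here `n = |z₁|²`, `t` is the height of the inverted point and `2nt = rho Z Z`. The factor
`4^(s-1)` comes from `t^(2-2s) = 4^(s-1) (2t)^(2-2s)`. -/
theorem cpow_scaling_identity (s : ℂ) {n t : ℝ} (hn : 0 < n) (ht : 0 < t) :
    ((2 * (n * t) : ℝ) : ℂ) ^ s * (n : ℂ) ^ (-s) * (t : ℂ) ^ (2 - 2 * s) =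
      (4 : ℂ) ^ (s - 1) * ((2 * (n * t) : ℝ) : ℂ) ^ (2 - s) * (n : ℂ) ^ (-(2 - s)) := by
  have hn' : (n : ℂ) ≠ 0 := Complex.ofReal_ne_zero.mpr hn.ne'
  have ht' : (t : ℂ) ≠ 0 := Complex.ofReal_ne_zero.mpr ht.ne'
  have hmul : ∀ z : ℂ, ((2 * (n * t) : ℝ) : ℂ) ^ z = (2 : ℂ) ^ z * ((n : ℂ) ^ z * (t : ℂ) ^ z) := by
    intro z
    rw [Complex.ofReal_mul, Complex.mul_cpow_ofReal_nonneg zero_le_two (by positivity),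
      Complex.ofReal_mul, Complex.mul_cpow_ofReal_nonneg hn.le ht.le, Complex.ofReal_ofNat]
  have h4 : (4 : ℂ) ^ (s - 1) = (2 : ℂ) ^ (s - 1) * (2 : ℂ) ^ (s - 1) := by
    rw [← Complex.ofReal_ofNat 2, ← Complex.mul_cpow_ofReal_nonneg zero_le_two zero_le_two]
    norm_num
  have h2 : (2 : ℂ) ^ (s - 1) * (2 : ℂ) ^ (s - 1) * (2 : ℂ) ^ (2 - s) = (2 : ℂ) ^ s := by
    rw [← Complex.cpow_add _ _ two_ne_zero, ← Complex.cpow_add _ _ two_ne_zero]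
    congr 1
    ring
  have ht2 : (t : ℂ) ^ s * (t : ℂ) ^ (2 - 2 * s) = (t : ℂ) ^ (2 - s) := by
    rw [← Complex.cpow_add _ _ ht']
    congr 1
    ring
  have hcancel : ∀ z : ℂ, (n : ℂ) ^ z * (n : ℂ) ^ (-z) = 1 := by
    intro z
    rw [← Complex.cpow_add _ _ hn', add_neg_cancel, Complex.cpow_zero]
  rw [hmul, hmul, h4, ← h2, ← ht2]
  linear_combination (2 : ℂ) ^ (s - 1) * (2 : ℂ) ^ (s - 1) * (2 : ℂ) ^ (2 - s) * (t : ℂ) ^ s *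
    (t : ℂ) ^ (2 - 2 * s) * (hcancel s - hcancel (2 - s))

theorem integral_intertwiningIntegrand {k : ℤ} (hk : k = 0 ∨ k = 1 ∨ k = -1) {s : ℂ}
    (hs : 1 < s.re) {Z : ℂ × ℂ} (hZ : Z ∈ siegelDomain) :
    ∫ p, intertwiningIntegrand k s Z 0 (boundaryPoint p) =
      (Real.pi : ℂ) ^ (3 / 2 : ℂ) * Complex.Gamma (s - 1 / 2) /
          (((|k| : ℤ) + s - 1) * Complex.Gamma s) *
        (4 : ℂ) ^ (s - 1) * weightedPoisson k Z 0 (2 - s) := by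
  have hZ' := siegelInversion_mem_siegelDomain hZ
  have hZ1 := fst_ne_zero_of_mem_siegelDomain hZ
  have hZ1' : starRingEnd ℂ Z.1 ≠ 0 := (map_ne_zero _).mpr hZ1
  have hre : 0 ≤ (starRingEnd ℂ Z.1).re := by
    rw [Complex.conj_re]
    linarith [mem_siegelDomain_iff.mp hZ, sq_nonneg ‖Z.2‖]
  have hrho : rho Z 0 = starRingEnd ℂ Z.1 := by simp [rho]
  have hcongr : ∀ᵐ p : ℂ × ℝ, Complex.normSq ((boundaryPoint p).1⁻¹) ^ 2 •
        intertwiningIntegrand k s Z 0 (boundaryPoint (boundaryInversion p)) =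
      rho Z Z ^ s * twistedPower k s (starRingEnd ℂ Z.1) *
        twistedPower k s (rho (siegelInversion Z) (boundaryPoint p)) := by
    filter_upwards [ae_ne_zero_complex_prod_real] with p hp
    exact intertwiningIntegrand_boundaryInversion k s hZ hp
  rw [← integral_comp_boundaryInversion, integral_congr_ae hcongr, integral_const_mul,
    integral_twistedPower_rho hk hs hZ',
    weightedPoisson_eq (by rwa [hrho]) (by rwa [hrho]), hrho, rho_self_eq_siegelInversion hZ,
    twistedPower, twistedPower, Complex.normSq_conj]
  have h := cpow_scaling_identity s (Complex.normSq_pos.mpr hZ1) (mem_siegelDomain_iff.mp hZ')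
  linear_combination ((Real.pi : ℂ) ^ (3 / 2 : ℂ) * Complex.Gamma (s - 1 / 2) /
    (((|k| : ℤ) + s - 1) * Complex.Gamma s) *
      (starRingEnd ℂ Z.1 / starRingEnd ℂ (starRingEnd ℂ Z.1)) ^ k) * h

theorem corollary4p12 (k : ℤ) (hk : k = 0 ∨ k = 1 ∨ k = -1) (s : ℂ) (hs : 1 < s.re)
    (Z : ℂ × ℂ) (hZ : Z ∈ siegelDomain) (W' : ℂ × ℂ) (hW' : W' ∈ siegelBoundary) :
    MeasureTheory.IntegrableOn
        (fun W : ℂ × ℂ => weightedPoisson k Z W s * rho W W' ^ (s + (k : ℂ) - 2) *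
          rho (conjPt W) (conjPt W') ^ (s - (k : ℂ) - 2))
        siegelBoundary boundaryMeasure ∧
      ∫ W in siegelBoundary, weightedPoisson k Z W s * rho W W' ^ (s + (k : ℂ) - 2) *
          rho (conjPt W) (conjPt W') ^ (s - (k : ℂ) - 2) ∂boundaryMeasure =
        (Real.pi : ℂ) ^ (3 / 2 : ℂ) * Complex.Gamma (s - 1 / 2) /
            (((|k| : ℤ) + s - 1) * Complex.Gamma s) *
          (4 : ℂ) ^ (s - 1) * weightedPoisson k Z W' (2 - s) := by
  obtain ⟨q, rfl⟩ := exists_eq_boundaryPoint hW'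
  obtain ⟨Y, rfl⟩ := exists_heisenbergAct_eq q Z
  have hY : Y ∈ siegelDomain := by
    rwa [mem_siegelDomain_iff_rho, rho_heisenbergAct, ← mem_siegelDomain_iff_rho] at hZ
  -- The point `W'` is the translate of the origin by `q`, so undoing that translation reduces to
  -- `W' = 0`.
  have hq : boundaryPoint q = heisenbergAct q 0 := by simp [heisenbergAct, boundaryPoint]
  have hshift : ∀ p, intertwiningIntegrand k s (heisenbergAct q Y) (boundaryPoint q)
      (boundaryPoint (heisenbergShift q p)) = intertwiningIntegrand k s Y 0 (boundaryPoint p) := by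
    intro p
    rw [boundaryPoint_heisenbergShift, hq, intertwiningIntegrand_heisenbergAct]
  have hP : weightedPoisson k (heisenbergAct q Y) (boundaryPoint q) (2 - s) =
      weightedPoisson k Y 0 (2 - s) := by
    simp only [hq, weightedPoisson, rho_conjPt, rho_heisenbergAct]
  change IntegrableOn (intertwiningIntegrand k s (heisenbergAct q Y) (boundaryPoint q))
    siegelBoundary boundaryMeasure ∧ ∫ W in siegelBoundary,
      intertwiningIntegrand k s (heisenbergAct q Y) (boundaryPoint q) W ∂boundaryMeasure = _
  rw [IntegrableOn, boundaryMeasure_restrict_siegelBoundary, boundaryMeasure,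
    measurableEmbedding_boundaryPoint.integrable_map_iff,
    measurableEmbedding_boundaryPoint.integral_map, hP,
    ← integral_intertwiningIntegrand hk hs hY]
  constructor
  · rw [← integrable_comp_heisenbergShift q]
    simpa only [Function.comp_apply, hshift] using integrable_intertwiningIntegrand k hs hY
  · rw [← integral_comp_heisenbergShift q]
    simp only [hshift]
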